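/- **Setting.** For $n\in\mathbb N$ and $L,R,\varepsilon>0$ let $X=[-R,R]^n$ and let $\mathcal F$ be the family of all convex functions $f\colon X\to\mathbb R$ that are $L$-Lipschitz in the $L^\infty$ norm. A point $x\in X$ is an $\varepsilon$-minimum of $f$ if $f(x)<\min_X f+\varepsilon$. An oracle $\mathcal O$ assigns to every $f\in\mathcal F$ and query $x\in X$ an answer $\mathcal O_f(x)$ in an arbitrary answer set; it is *local* if $\mathcal O_f(x)=\mathcal O_g(x)$ whenever $f=g$ in a neighbourhood of $x$ in $X$. A deterministic algorithm adaptively chooses, from the answers received so far, either a next query in $X$, or to stop and return a point of $X$. Let $T_A(f,\varepsilon)$ be the number of queries that $A$ asks on instance $f$ before it stops, if it returns an $\varepsilon$-minimum of $f$, and $T_A(f,\varepsilon)=\infty$ otherwise. The distributional complexity is $$\mathrm{Compl}_{\mathcal D}(\mathcal O,\varepsilon)=\sup_F\inf_A\mathbb E_F[T_A(F,\varepsilon)],$$ and for real $\eta$ the high-probability complexity with slack $\eta$ is $$\mathrm{Compl}_{\mathcal{HP}}^{\eta}(\mathcal O,\varepsilon)=\sup_F\inf_A\sup\{\tau : \mathbb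 P_F[T_A(F,\varepsilon)\ge\tau]\ge 1-\eta\},$$ where $F$ runs over the discrete probability distributions on $\mathcal F$ and $A$ over the deterministic algorithms. (Restricting $F$ to discrete distributions avoids measurability questions and only makes lower bounds stronger.) For $P_e\in[0,1]$, the bounded-error complexities $\mathrm{Compl}_{\mathcal D,P_e}$ and $\mathrm{Compl}^{\eta}_{\mathcal{HP},P_e}$ are $$\sup_F\inf_B\mathbb E[T]\qquad\text{and}\qquad \sup_F\inf_B\sup\{\tau:\mathbb P[T\ge\tau]\ge 1-P_e-\eta\},$$ where $B$ runs over the randomized algorithms (probability distributions on deterministic algorithms for which, on every instance, the number of queries and the event of success are measurable) whose probability of failing to return an $\varepsilon$-minimum is at most $P_e$, over the random instance $F$ and the independent randomness of $B$; $T$ is the number of queries asked by $B$ (whether or not it succeeds). **Theorem 6.4.** There are absolute constants $c>0$ and $C$, and a function $\eta\colon\mathbb R\to\mathbb R$ with $\eta(N)\to0$ as $N\to\infty$, such that for all $n$, all $L,R,\varepsilon>0$ and every local oracle $\mathcal O$ for $\mathcal F$, with $N=n\log_2\frac{LR}{\varepsilon}$ (the bounds being trivial if $N\le 0$): 1. $\mathrm{Compl}_{\mathcal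 D}(\mathcal O,\varepsilon)\ge cN$ and $\mathrm{Compl}_{\mathcal{HP}}^{\eta(N)}(\mathcal O,\varepsilon)\ge cN$; that is, both are $\Omega\left(n\log\frac{LR}{\varepsilon}\right)$. 2. For every $P_e\in[0,1]$: $\mathrm{Compl}_{\mathcal D,P_e}(\mathcal O,\varepsilon)\ge c(1-P_e)N$ whenever $(1-P_e)N\ge C$; that is, it is $\Omega\left((1-P_e)\,n\log\frac{LR}{\varepsilon}\right)$. Moreover $\mathrm{Compl}_{\mathcal{HP},P_e}^{\eta(N)}(\mathcal O,\varepsilon)\ge cN$; that is, it is $\Omega\left(n\log\frac{LR}{\varepsilon}\right)$. -/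

import Mathlib

open Filter Topology MeasureTheory
open scoped ENNReal

noncomputable section

/-- The box `[-R, R]^n`, as the closed `L^∞`-ball of radius `R` around the origin
(the norm of `Fin n → ℝ` is the sup norm). -/
abbrev Box (n : ℕ) (R : ℝ) : Set (Fin n → ℝ) := Metric.closedBall 0 R

/-- The family of all real functions on the box that are convex and `L`-Lipschitz in the
`L^∞` norm. Its members are functions on the box itself: values outside play no role. -/
def lipschitzConvex (n : ℕ) (L R : ℝ) : Set (Box n R → ℝ) :=
  {f | ∃ g : (Fin n → ℝ) → ℝ, ConvexOn ℝ (Box n R) g ∧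
    (∀ x ∈ Box n R, ∀ y ∈ Box n R, |g x - g y| ≤ L * ‖x - y‖) ∧ f = fun x : Box n R => g x}

/-- `x` is an `ε`-minimum of `f`: `f x < min f + ε`. -/
def IsEpsMin {X : Type*} (f : X → ℝ) (ε : ℝ) (x : X) : Prop :=
  ∃ m, IsLeast (Set.range f) m ∧ f x < m + ε

/-- An oracle for the family `𝓕` (its answer to query `x` on instance `f` is `O f x`) is local
if instances that agree in a neighbourhood of `x` receive the same answer at `x`. -/
def IsLocalOracle {X Ans : Type*} [TopologicalSpace X] {𝓕 : Set (X → ℝ)}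
    (O : 𝓕 → X → Ans) : Prop :=
  ∀ (f g : 𝓕) (x : X), (f : X → ℝ) =ᶠ[𝓝 x] (g : X → ℝ) → O f x = O g x

/-- A deterministic oracle algorithm. From the list of the oracle answers received so far (which
determines the transcript) it either asks a next query (`Sum.inl x`), or stops and returns a
point (`Sum.inr y`). -/
abbrev Algorithm (X Ans : Type*) := List Ans → X ⊕ X

namespace Algorithm

variable {X Ans : Type*}

/-- The answers received during the first `t` steps, if queries are answered by `o`. Nothing
happens any more once the algorithm has stopped. -/
def answers (A : Algorithm X Ans) (o : X → Ans) : ℕ → List Ans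
  | 0 => []
  | t + 1 =>
    match A (answers A o t) with
    | Sum.inl x => answers A o t ++ [o x]
    | Sum.inr _ => answers A o t

/-- The number of queries asked before stopping; `⊤` if the algorithm never stops. -/
def numQueries (A : Algorithm X Ans) (o : X → Ans) : ℝ≥0∞ :=
  ⨅ (t : ℕ) (_ : ∃ y, A (A.answers o t) = Sum.inr y), (t : ℝ≥0∞)

/-- The algorithm stops and returns an `ε`-minimum of `f`. -/
def Finds (A : Algorithm X Ans) (o : X → Ans) (f : X → ℝ) (ε : ℝ) : Prop :=
  ∃ t y, A (A.answers o t) = Sum.inr y ∧ IsEpsMin f ε y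

open Classical in
/-- The number of queries required to find an `ε`-minimum of `f`; `⊤` if none is found. -/
def solveTime (A : Algorithm X Ans) (o : X → Ans) (f : X → ℝ) (ε : ℝ) : ℝ≥0∞ :=
  if A.Finds o f ε then A.numQueries o else ⊤

end Algorithm

section Complexity

variable {X Ans : Type*} {𝓕 : Set (X → ℝ)}

/-- Distributional complexity: `sup_F inf_A E[T_A(F, ε)]`. The supremum is over the discrete
probability distributions on `𝓕`, so that no measurability of the oracle or of the algorithm is
needed; a lower bound for it is all the more one for more general distributions. -/
def complexityD (O : 𝓕 → X → Ans) (ε : ℝ) : ℝ≥0∞ :=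
  ⨆ p : PMF 𝓕, ⨅ A : Algorithm X Ans, ∑' f : 𝓕, p f * A.solveTime (O f) f ε

/-- High-probability complexity: the supremum over (discrete) distributions of the infimum over
algorithms of the largest `τ` with `P[T_A(F, ε) ≥ τ] ≥ 1 - η`. -/
def complexityHP (O : 𝓕 → X → Ans) (ε η : ℝ) : ℝ≥0∞ :=
  ⨆ p : PMF 𝓕, ⨅ A : Algorithm X Ans,
    sSup {τ : ℝ≥0∞ |
      ENNReal.ofReal (1 - η) ≤ p.toOuterMeasure {f | τ ≤ A.solveTime (O f) f ε}}

/-- A randomized algorithm: a probability distribution on the deterministic algorithms, for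
which the number of queries and the event of success on an instance are measurable. -/
structure RandomizedAlgorithm (O : 𝓕 → X → Ans) (ε : ℝ) where
  mAlg : MeasurableSpace (Algorithm X Ans)
  law : Measure (Algorithm X Ans)
  isProb : IsProbabilityMeasure law
  measurable_numQueries : ∀ f : 𝓕, Measurable fun A : Algorithm X Ans => A.numQueries (O f)
  measurableSet_finds : ∀ f : 𝓕, MeasurableSet {A : Algorithm X Ans | A.Finds (O f) f ε}

namespace RandomizedAlgorithm

variable {O : 𝓕 → X → Ans} {ε : ℝ}

/-- Probability, over the instance drawn from `p` and the independent coins of the algorithm,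
that no `ε`-minimum is returned. -/
def errorProb (B : RandomizedAlgorithm O ε) (p : PMF 𝓕) : ℝ≥0∞ :=
  ∑' f : 𝓕, p f * B.law {A | ¬ A.Finds (O f) f ε}

/-- Expected number of queries `E[T]`. -/
def expectedQueries (B : RandomizedAlgorithm O ε) (p : PMF 𝓕) : ℝ≥0∞ :=
  ∑' f : 𝓕, p f * @lintegral _ B.mAlg B.law (fun A => A.numQueries (O f))

/-- The probability `P[T ≥ τ]`. -/
def probQueriesGE (B : RandomizedAlgorithm O ε) (p : PMF 𝓕) (τ : ℝ≥0∞) : ℝ≥0∞ :=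
  ∑' f : 𝓕, p f * B.law {A | τ ≤ A.numQueries (O f)}

end RandomizedAlgorithm

/-- Distributional complexity for algorithms with error probability at most `Pe`:
`sup_F inf_B E[T]`, with `B` over the randomized algorithms that err with probability at most
`Pe` on an instance drawn from `F`. -/
def complexityDBounded (O : 𝓕 → X → Ans) (ε Pe : ℝ) : ℝ≥0∞ :=
  ⨆ p : PMF 𝓕, ⨅ (B : RandomizedAlgorithm O ε) (_ : B.errorProb p ≤ ENNReal.ofReal Pe),
    B.expectedQueries p

/-- High-probability complexity for algorithms with error probability at most `Pe`: as above,
with the largest `τ` such that `P[T ≥ τ] ≥ 1 - Pe - η` in place of `E[T]`. -/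
def complexityHPBounded (O : 𝓕 → X → Ans) (ε Pe η : ℝ) : ℝ≥0∞ :=
  ⨆ p : PMF 𝓕, ⨅ (B : RandomizedAlgorithm O ε) (_ : B.errorProb p ≤ ENNReal.ofReal Pe),
    sSup {τ : ℝ≥0∞ | ENNReal.ofReal (1 - Pe - η) ≤ B.probQueriesGE p τ}

end Complexity

end

/-! The hard functions are maxima of one-dimensional pieces `slope * |x i - kink| + offset + δ`. For
each coordinate `i` and level `k`, one hidden bit moves the kink left or right of the previous one
by a prescribed step. There are `m = n * M` bits `S`, with `m` of order `N`.

At a point `x`, a bit is relevant if its piece would reach the maximum were the bit to point away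
from `x`. Relevant bits form an initial segment of levels in each coordinate, and they determine the
function near `x`, so a local oracle reveals nothing else (`Ladder.relevant_local`). A relevant bit
that does point away is a maximizer. The small perturbations `δ`, drawn from a grid of `K` values,
make it unlikely that two such bits are met for the first time at one query: a fresh tie fixes one
coordinate of `δ` in terms of the others (`Ladder.not_isTie_of_lt`). Outside ties each query thus
yields at most one new wrong guess. At an `ε`-minimum all bits are relevant and none is wrong.

Replaying the strategy, one recovers `S` from the set of bits that were wrong when first explored
(`card_explored_le`). Hence at most as many strings are solved with `T` queries as there are subsets
of size at most `T`, an exponentially small fraction of `2 ^ m` when `8 * T ≤ m`. With the tie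
probability added, any deterministic algorithm is fast and correct on at most a fraction `(7 / 8) ^
m` of the instances. Averaging over the coins extends this to randomized algorithms, and Markov's
inequality gives the expectation bounds. -/

noncomputable section

/-! ### Algorithms as non-stopping query strategies -/

namespace Algorithm

variable {X Ans : Type*}

/-- The next point of an algorithm, no matter whether it is queried or returned. -/
def probe (A : Algorithm X Ans) (l : List Ans) : X := (A l).elim id id

/-- The answers to the first `t` queries of the strategy `z`. -/
def transcript (z : List Ans → X) (o : X → Ans) : ℕ → List Ans
  | 0 => []
  | t + 1 => transcript z o t ++ [o (z (transcript z o t))]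

/-- Stopping freezes the list of answers, so the returned point does not depend on the time at which
the algorithm is inspected. -/
theorem answers_succ_of_stop (A : Algorithm X Ans) (o : X → Ans) {t : ℕ} {y : X}
    (h : A (A.answers o t) = Sum.inr y) : A.answers o (t + 1) = A.answers o t := by
  simp [answers, h]

theorem answers_of_stop (A : Algorithm X Ans) (o : X → Ans) {t s : ℕ} {y : X}
    (h : A (A.answers o t) = Sum.inr y) (hts : t ≤ s) : A.answers o s = A.answers o t := by
  induction s, hts using Nat.le_induction with
  | base => rfl
  | succ s _ ih => rw [answers_succ_of_stop A o (y := y) (by rw [ih, h]), ih]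

theorem answers_eq_transcript (A : Algorithm X Ans) (o : X → Ans) (t : ℕ)
    (h : ∀ s < t, ¬ ∃ y, A (A.answers o s) = Sum.inr y) :
    A.answers o t = transcript A.probe o t := by
  induction t with
  | zero => rfl
  | succ t ih =>
    have ih' := ih fun s hs => h s (hs.trans (Nat.lt_succ_self t))
    have ht := h t (Nat.lt_succ_self t)
    cases hA : A (A.answers o t) with
    | inl x =>
      have hp : A.probe (transcript A.probe o t) = x := by
        rw [← ih']; simp [probe, hA]
      simp only [answers, hA, transcript, hp]
      rw [ih']
    | inr y => exact absurd ⟨y, hA⟩ ht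

/-- An algorithm that succeeds with few queries probes an `ε`-minimum early. -/
theorem exists_probe_isEpsMin {A : Algorithm X Ans} {o : X → Ans} {f : X → ℝ} {ε : ℝ}
    {τ : ℝ≥0∞} (hf : A.Finds o f ε) (hq : A.numQueries o < τ) :
    ∃ t : ℕ, (t : ℝ≥0∞) < τ ∧ IsEpsMin f ε (A.probe (transcript A.probe o t)) := by
  classical
  obtain ⟨t', y', hA', hy'⟩ := hf
  simp only [numQueries, iInf_lt_iff] at hq
  obtain ⟨t, ht, htτ⟩ := hq
  have hex : ∃ s, ∃ y, A (A.answers o s) = Sum.inr y := ⟨t, ht⟩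
  obtain ⟨y, hy⟩ := Nat.find_spec hex
  have hle : Nat.find hex ≤ t := Nat.find_min' hex ht
  have hle' : Nat.find hex ≤ t' := Nat.find_min' hex ⟨y', hA'⟩
  refine ⟨Nat.find hex, lt_of_le_of_lt (by exact_mod_cast hle) htτ, ?_⟩
  rw [← answers_eq_transcript A o _ fun s hs => Nat.find_min hex hs]
  rw [answers_of_stop A o hy hle', hy] at hA'
  rw [probe, hy]
  exact (Sum.inr.inj hA') ▸ hy'

end Algorithm

/-! ### Local agreement of maxima; counting small sets -/

/-- Two finite maxima of continuous functions agree near a point if the families agree on a set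
of indices which contains all the maximizers at that point. -/
theorem sup'_eventuallyEq {X J : Type*} [TopologicalSpace X] [Fintype J] [Nonempty J]
    {u v : J → X → ℝ} (hu : ∀ j, Continuous (u j)) (hv : ∀ j, Continuous (v j)) (x : X)
    (s : Set J) (huv : ∀ j ∈ s, u j = v j)
    (hsu : ∀ j ∉ s, u j x < Finset.univ.sup' Finset.univ_nonempty fun i => u i x)
    (hsv : ∀ j ∉ s, v j x < Finset.univ.sup' Finset.univ_nonempty fun i => v i x) :
    (fun y => Finset.univ.sup' Finset.univ_nonempty fun i => u i y) =ᶠ[𝓝 x]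
      fun y => Finset.univ.sup' Finset.univ_nonempty fun i => v i y := by
  have key : ∀ w : J → X → ℝ, (∀ j, Continuous (w j)) →
      (∀ j ∉ s, w j x < Finset.univ.sup' Finset.univ_nonempty fun i => w i x) →
      ∀ᶠ y in 𝓝 x, ∀ j ∉ s, w j y < Finset.univ.sup' Finset.univ_nonempty fun i => w i y := by
    intro w hw hsw
    refine eventually_all.2 fun j => ?_
    by_cases hj : j ∈ s
    · exact Eventually.of_forall fun y h => absurd hj h
    · have hc : Continuous fun y => Finset.univ.sup' Finset.univ_nonempty fun i => w i y :=
        Continuous.finset_sup'_apply _ fun i _ => hw i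
      filter_upwards [(hw j).continuousAt.eventually_lt hc.continuousAt (hsw j hj)] with y hy _
      exact hy
  filter_upwards [key u hu hsu, key v hv hsv] with y h1 h2
  apply le_antisymm
  · obtain ⟨j, -, hj⟩ := Finset.exists_mem_eq_sup' Finset.univ_nonempty fun i => u i y
    have hjs : j ∈ s := by
      by_contra h
      exact (h1 j h).ne hj.symm
    rw [hj, huv j hjs]
    exact Finset.le_sup' (fun i => v i y) (Finset.mem_univ j)
  · obtain ⟨j, -, hj⟩ := Finset.exists_mem_eq_sup' Finset.univ_nonempty fun i => v i y
    have hjs : j ∈ s := by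
      by_contra h
      exact (h2 j h).ne hj.symm
    rw [hj, ← huv j hjs]
    exact Finset.le_sup' (fun i => u i y) (Finset.mem_univ j)

/-- There are few small subsets. -/
theorem card_small_subsets_le (J : Type*) [Fintype J] [DecidableEq J] (T : ℕ)
    (hT : 8 * T ≤ Fintype.card J) :
    (((Finset.univ : Finset (Finset J)).filter fun W => W.card ≤ T).card : ℝ) ≤
      (3 / 4) ^ Fintype.card J * 2 ^ Fintype.card J := by
  set m := Fintype.card J
  -- Exponential weights: `4 ^ (T - |W|)` is at least `1` on the sets counted. The factor `8` in
  -- `hT` is what `4 ≤ (6 / 5) ^ 8` needs, and `6 / 5 * (5 / 4) = 3 / 4 * 2`.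
  have h1 : (((Finset.univ : Finset (Finset J)).filter fun W => W.card ≤ T).card : ℝ) ≤
      ∑ W : Finset J, (4 : ℝ) ^ T * (1 / 4) ^ W.card := by
    rw [Finset.card_eq_sum_ones, Nat.cast_sum, Finset.sum_filter]
    refine Finset.sum_le_sum fun W _ => ?_
    split_ifs with h
    · rw [one_div, inv_pow, ← div_eq_mul_inv, Nat.cast_one, one_le_div (by positivity)]
      exact pow_le_pow_right₀ (by norm_num) h
    · positivity
  have h2 : ∑ W : Finset J, (1 / 4 : ℝ) ^ W.card = (5 / 4) ^ m := by
    have := Finset.sum_pow_mul_eq_add_pow (1 / 4 : ℝ) 1 (Finset.univ : Finset J)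
    simp only [one_pow, mul_one, Finset.powerset_univ, Finset.card_univ] at this
    rw [this]; norm_num [m]
  rw [← Finset.mul_sum, h2] at h1
  refine h1.trans ?_
  have h3 : (4 : ℝ) ^ T ≤ (6 / 5) ^ m := by
    calc (4 : ℝ) ^ T ≤ ((6 / 5) ^ 8) ^ T := by gcongr; norm_num
      _ = (6 / 5) ^ (8 * T) := by rw [pow_mul]
      _ ≤ (6 / 5) ^ m := pow_le_pow_right₀ (by norm_num) hT
  calc (4 : ℝ) ^ T * (5 / 4) ^ m ≤ (6 / 5) ^ m * (5 / 4) ^ m := by gcongr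
    _ = (3 / 4) ^ m * 2 ^ m := by rw [← mul_pow, ← mul_pow]; norm_num

/-! ### Encoding hidden strings by their first mistakes -/

section Encoding

variable {J X Ans : Type*} [DecidableEq J]

/-- The `t`-th point of the strategy `z`. -/
def probeAt (z : List Ans → X) (o : X → Ans) (t : ℕ) : X :=
  z (Algorithm.transcript z o t)

/-- The bits explored before step `t`. -/
def explored (z : List Ans → X) (o : X → Ans) (E : X → Finset J) (t : ℕ) : Finset J :=
  (Finset.range t).biUnion fun s => E (probeAt z o s)

/-- The bits which are explored for the first time at step `t`, and guessed wrong there. -/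
def freshMistakes (z : List Ans → X) (o : X → Ans) (E W : X → Finset J) (t : ℕ) : Finset J :=
  (E (probeAt z o t) ∩ W (probeAt z o t)) \ explored z o E t

theorem mem_explored {z : List Ans → X} {o : X → Ans} {E : X → Finset J} {t : ℕ} {j : J} :
    j ∈ explored z o E t ↔ ∃ s < t, j ∈ E (probeAt z o s) := by
  simp [explored]

theorem mem_freshMistakes {z : List Ans → X} {o : X → Ans} {E W : X → Finset J} {t : ℕ} {j : J} :
    j ∈ freshMistakes z o E W t ↔
      (j ∈ E (probeAt z o t) ∧ j ∈ W (probeAt z o t)) ∧ j ∉ explored z o E t := by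
  simp [freshMistakes]

/-- A bit is fresh at only one step, so the union over all steps still records the outcome of its
first exploration; this is what makes the encoding decodable. -/
theorem mem_biUnion_freshMistakes_iff {z : List Ans → X} {o : X → Ans} {E W : X → Finset J}
    {T t : ℕ} (ht : t ≤ T) {j : J} (hj : j ∈ E (probeAt z o t)) (hn : j ∉ explored z o E t) :
    j ∈ (Finset.range (T + 1)).biUnion (freshMistakes z o E W) ↔ j ∈ W (probeAt z o t) := by
  simp only [Finset.mem_biUnion, Finset.mem_range, mem_freshMistakes]
  constructor
  · rintro ⟨s, -, ⟨hs1, hs2⟩, hs3⟩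
    rcases lt_trichotomy s t with h | rfl | h
    · exact absurd (mem_explored.2 ⟨s, h, hs1⟩) hn
    · exact hs2
    · exact absurd (mem_explored.2 ⟨t, h, hj⟩) hs3
  · exact fun h => ⟨t, Nat.lt_succ_of_le ht, ⟨hj, h⟩, hn⟩

/-- A hidden string is determined by the set of the bits which were wrong when they were explored
first. So there are few strings all of whose bits get explored with few mistakes. -/
theorem card_explored_le [Fintype J] (z : List Ans → X) (o : (J → Bool) → X → Ans)
    (E W : (J → Bool) → X → Finset J)
    (hE : ∀ x S S', (∀ j ∈ E S x, j ∈ E S' x → S j = S' j ∨ (j ∈ W S x ↔ j ∈ W S' x)) →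
      E S x = E S' x ∧ (∀ j ∈ E S x, S j = S' j) ∧ o S x = o S' x)
    (T : ℕ) (G : Finset (J → Bool))
    (hG : ∀ S ∈ G, ∀ t ≤ T, (freshMistakes z (o S) (E S) (W S) t).card ≤ 1)
    (hG' : ∀ S ∈ G, ∃ t ≤ T, E S (probeAt z (o S) t) = Finset.univ ∧
      freshMistakes z (o S) (E S) (W S) t = ∅) :
    G.card ≤ ((Finset.univ : Finset (Finset J)).filter fun V => V.card ≤ T).card := by
  refine Finset.card_le_card_of_injOn
    (fun S => (Finset.range (T + 1)).biUnion (freshMistakes z (o S) (E S) (W S))) ?_ ?_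
  · intro S hS
    obtain ⟨t, htT, -, ht⟩ := hG' S hS
    simp only [Finset.coe_filter, Finset.mem_univ, true_and, Set.mem_ofPred_eq]
    -- The successful step contributes no mistake, so the `T + 1` steps together contribute at most
    -- `T`.
    have htm : t ∈ Finset.range (T + 1) := Finset.mem_range.2 (Nat.lt_succ_of_le htT)
    rw [← Finset.insert_erase htm, Finset.biUnion_insert, ht, Finset.empty_union]
    refine Finset.card_biUnion_le.trans ?_
    calc ∑ s ∈ (Finset.range (T + 1)).erase t, (freshMistakes z (o S) (E S) (W S) s).card
        ≤ ∑ s ∈ (Finset.range (T + 1)).erase t, 1 := Finset.sum_le_sum fun s hs =>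
          hG S hS s (Nat.le_of_lt_succ (Finset.mem_range.1 (Finset.mem_of_mem_erase hs)))
      _ = T := by simp [Finset.card_erase_of_mem htm]
  · intro S hS S' _ hSS'
    -- Decoding: two strings with the same mistake set are run in parallel. At a common point,
    -- previously explored bits agree by induction, and for fresh ones the common set tells whether
    -- they are wrong, so `hE` gives the same exploration and the same answer.
    have key : ∀ t ≤ T + 1,
        Algorithm.transcript z (o S) t = Algorithm.transcript z (o S') t ∧
        explored z (o S) (E S) t = explored z (o S') (E S') t ∧
        ∀ j ∈ explored z (o S) (E S) t, S j = S' j := by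
      intro t
      induction t with
      | zero => intro _; simp [Algorithm.transcript, explored]
      | succ t ih =>
        intro ht
        obtain ⟨h1, h2, h3⟩ := ih (by omega)
        have hx : probeAt z (o S) t = probeAt z (o S') t := by simp only [probeAt, h1]
        have htT : t ≤ T := by omega
        obtain ⟨e1, e2, e3⟩ := hE (probeAt z (o S) t) S S' (by
          intro j hj hj'
          by_cases hn : j ∈ explored z (o S) (E S) t
          · exact Or.inl (h3 j hn)
          · right
            rw [← mem_biUnion_freshMistakes_iff htT hj hn]
            rw [hx] at hj' ⊢
            rw [h2] at hn
            rw [← mem_biUnion_freshMistakes_iff htT hj' hn]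
            exact iff_of_eq (congrArg (j ∈ ·) hSS'))
        refine ⟨?_, ?_, ?_⟩
        · simp only [Algorithm.transcript]
          rw [← h1]
          simp only [probeAt] at e3
          rw [e3]
        · rw [explored, Finset.range_add_one, Finset.biUnion_insert, explored,
            Finset.range_add_one, Finset.biUnion_insert, ← hx, e1]
          exact congrArg _ h2
        · intro j hj
          rw [explored, Finset.range_add_one, Finset.biUnion_insert, Finset.mem_union] at hj
          exact hj.elim (e2 j) (h3 j)
    obtain ⟨t, htT, ht, -⟩ := hG' S hS
    funext j
    refine (key (T + 1) le_rfl).2.2 j (mem_explored.2 ⟨t, by omega, ?_⟩)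
    rw [ht]; exact Finset.mem_univ j

/-- If one coordinate of `D` is determined by everything else for the members of `B`, then the
density of `B` is at most `1 / K`. -/
theorem card_mul_le_of_update [Fintype J] {α : Type*} [Fintype α] {K : ℕ}
    (B : Finset (α × (J → Fin K))) (j : J)
    (h : ∀ S D a, (S, D) ∈ B → (S, Function.update D j a) ∈ B → a = D j) :
    B.card * K ≤ Fintype.card (α × (J → Fin K)) := by
  have hprod : B.card * K = (B ×ˢ (Finset.univ : Finset (Fin K))).card := by
    rw [Finset.card_product, Finset.card_univ, Fintype.card_fin]
  rw [hprod, ← Finset.card_univ]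
  -- The `j`-th coordinate of the image gives back `a`; the overwritten value `D j` is forced by
  -- `h`, so nothing is lost.
  refine Finset.card_le_card_of_injOn (fun q => (q.1.1, Function.update q.1.2 j q.2))
    (fun _ _ => Finset.mem_coe.2 (Finset.mem_univ _)) ?_
  rintro ⟨⟨S, D⟩, a⟩ hq ⟨⟨S', D'⟩, a'⟩ hq' heq
  simp only [Finset.coe_product, Set.mem_prod, Finset.mem_coe] at hq hq'
  obtain ⟨rfl, hD⟩ := Prod.mk.inj heq
  have ha : a = a' := by simpa using congrFun hD j
  have hoff : ∀ i, i ≠ j → D i = D' i := fun i hi => by simpa [hi] using congrFun hD i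
  have hup : Function.update D j (D' j) = D' := by
    funext i
    by_cases hi : i = j
    · subst hi; simp
    · simp [hi, hoff i hi]
  have hj := h S D (D' j) hq.1 (by rw [hup]; exact hq'.1)
  rw [hj, Function.update_eq_self] at hup
  rw [hup, ha]

end Encoding

/-! ### Hard instances with nested kinks -/

/-- The parameters of a hard family: level `k` has slope `slope k`, its kink is at distance
`step k` from the previous one, and `tail k` bounds the total length of the later steps. -/
structure Ladder (M : ℕ) (L R ε θ : ℝ) where
  slope : ℕ → ℝ
  step : ℕ → ℝ
  offset : ℕ → ℝ
  tail : ℕ → ℝ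
  slope_nonneg : ∀ k, 0 ≤ slope k
  slope_le : ∀ k, slope k ≤ L
  slope_anti : ∀ k, slope (k + 1) ≤ slope k
  step_nonneg : ∀ k, 0 ≤ step k
  tail_nonneg : ∀ k, 0 ≤ tail k
  step_add_tail : ∀ k, step (k + 1) + tail (k + 1) ≤ tail k
  step_zero_add_tail : step 0 + tail 0 ≤ R
  gap : ∀ k, k + 1 < M →
    slope (k + 1) * (step k + step (k + 1)) + offset (k + 1) + θ < slope k * step k + offset k
  bottom : ∀ k < M, slope k * tail k + offset k ≤ 0
  height : ∀ k < M, ε + θ ≤ slope k * step k + offset k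

namespace Ladder

variable {n M : ℕ} {L R ε θ : ℝ} (P : Ladder M L R ε θ)

/-- The bit of level `l` in coordinate `i`. -/
def bitAt (S : Fin n × Fin M → Bool) (i : Fin n) (l : ℕ) : Bool :=
  if h : l < M then S (i, ⟨l, h⟩) else false

/-- The kink in coordinate `i` that is encoded by the first `k` bits. -/
def center (S : Fin n × Fin M → Bool) (i : Fin n) (k : ℕ) : ℝ :=
  ∑ l ∈ Finset.range k, if bitAt S i l then P.step l else -P.step l

/-- The function of level `j.2` in coordinate `j.1`. -/
def piece (S : Fin n × Fin M → Bool) (δ : Fin n × Fin M → ℝ) (j : Fin n × Fin M)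
    (x : Fin n → ℝ) : ℝ :=
  P.slope j.2 * |x j.1 - P.center S j.1 (j.2 + 1)| + P.offset j.2 + δ j

/-- The value of `piece` if the bit `j` points away from `x`. -/
def cap (S : Fin n × Fin M → Bool) (δ : Fin n × Fin M → ℝ) (j : Fin n × Fin M)
    (x : Fin n → ℝ) : ℝ :=
  P.slope j.2 * (|x j.1 - P.center S j.1 j.2| + P.step j.2) + P.offset j.2 + δ j

/-- The hard instance: the maximum of all pieces. -/
def value [NeZero n] [NeZero M] (S : Fin n × Fin M → Bool) (δ : Fin n × Fin M → ℝ)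
    (x : Fin n → ℝ) : ℝ :=
  Finset.univ.sup' Finset.univ_nonempty fun j => P.piece S δ j x

/-- The bits whose value matters at `x`. -/
def relevant [NeZero n] [NeZero M] (S : Fin n × Fin M → Bool) (δ : Fin n × Fin M → ℝ)
    (x : Fin n → ℝ) : Finset (Fin n × Fin M) :=
  {j | P.value S δ x ≤ P.cap S δ j x}

/-- The bits pointing away from `x`. -/
def wrong (S : Fin n × Fin M → Bool) (x : Fin n → ℝ) : Finset (Fin n × Fin M) :=
  {j | S j ≠ decide (P.center S j.1 j.2 ≤ x j.1)}

theorem mem_wrong {S : Fin n × Fin M → Bool} {x : Fin n → ℝ} {j : Fin n × Fin M} :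
    j ∈ P.wrong S x ↔ S j ≠ decide (P.center S j.1 j.2 ≤ x j.1) := by
  simp [wrong]

theorem center_succ (S : Fin n × Fin M → Bool) (j : Fin n × Fin M) :
    P.center S j.1 (j.2 + 1) =
      P.center S j.1 j.2 + if S j then P.step j.2 else -P.step j.2 := by
  rw [center, Finset.sum_range_succ, center]
  simp [bitAt]

theorem center_congr {S S' : Fin n × Fin M → Bool} {i : Fin n} {k : ℕ}
    (h : ∀ l : Fin M, (l : ℕ) < k → S (i, l) = S' (i, l)) : P.center S i k = P.center S' i k := by
  refine Finset.sum_congr rfl fun l hl => ?_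
  have : bitAt S i l = bitAt S' i l := by
    unfold bitAt
    split_ifs with hM
    · exact h ⟨l, hM⟩ (Finset.mem_range.1 hl)
    · rfl
  rw [this]

/-- Telescoping `step_add_tail`: later kinks stay within `tail k` of the kink of level `k`, whatever
the later bits are. -/
theorem abs_center_sub_le (S : Fin n × Fin M → Bool) (i : Fin n) (k m : ℕ) :
    |P.center S i (k + 1 + m) - P.center S i (k + 1)| ≤ P.tail k - P.tail (k + m) := by
  induction m with
  | zero => simp
  | succ m ih =>
    have h1 : P.center S i (k + 1 + (m + 1)) = P.center S i (k + 1 + m) +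
        if bitAt S i (k + 1 + m) then P.step (k + 1 + m) else -P.step (k + 1 + m) := by
      rw [← add_assoc, center, Finset.sum_range_succ, center]
    have h2 : |if bitAt S i (k + 1 + m) then P.step (k + 1 + m) else -P.step (k + 1 + m)| ≤
        P.step (k + 1 + m) := by
      split_ifs <;> simp [abs_of_nonneg (P.step_nonneg _)]
    have h3 := P.step_add_tail (k + m)
    rw [show k + 1 + m = k + m + 1 by ring] at *
    rw [show k + (m + 1) = k + m + 1 by ring, h1]
    rw [abs_le] at *
    constructor <;> linarith [h2.1, h2.2, ih.1, ih.2]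

theorem abs_center_le (S : Fin n × Fin M → Bool) (i : Fin n) (k : ℕ) :
    |P.center S i (k + 1)| ≤ R := by
  have h1 := P.abs_center_sub_le S i 0 k
  have h2 : |P.center S i (0 + 1)| ≤ P.step 0 := by
    simp only [center, zero_add, Finset.range_one, Finset.sum_singleton]
    split_ifs <;> simp [abs_of_nonneg (P.step_nonneg _)]
  have h3 := P.step_zero_add_tail
  have h4 := P.tail_nonneg (0 + k)
  rw [show 0 + 1 + k = k + 1 by ring] at h1
  rw [abs_le] at *
  constructor <;> linarith [h2.1, h2.2, h1.1, h1.2]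

theorem piece_le_cap (S : Fin n × Fin M → Bool) (δ : Fin n × Fin M → ℝ) (j : Fin n × Fin M)
    (x : Fin n → ℝ) : P.piece S δ j x ≤ P.cap S δ j x := by
  have h : |x j.1 - P.center S j.1 (j.2 + 1)| ≤ |x j.1 - P.center S j.1 j.2| + P.step j.2 := by
    rw [center_succ]
    have := P.step_nonneg j.2
    have h1 := neg_abs_le (x j.1 - P.center S j.1 j.2)
    have h2 := le_abs_self (x j.1 - P.center S j.1 j.2)
    rw [abs_le]
    split_ifs <;> constructor <;> linarith
  unfold piece cap
  have := mul_le_mul_of_nonneg_left h (P.slope_nonneg j.2)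
  linarith

/-- Pointing away from `x` moves the kink away by the full step, so the triangle inequality in
`piece_le_cap` is sharp. Consequently a relevant wrong bit attains the maximum. -/
theorem piece_eq_cap {S : Fin n × Fin M → Bool} (δ : Fin n × Fin M → ℝ) {j : Fin n × Fin M}
    {x : Fin n → ℝ} (h : j ∈ P.wrong S x) : P.piece S δ j x = P.cap S δ j x := by
  rw [mem_wrong] at h
  have h : |x j.1 - P.center S j.1 (j.2 + 1)| = |x j.1 - P.center S j.1 j.2| + P.step j.2 := by
    rw [center_succ]
    have hs := P.step_nonneg j.2
    by_cases hc : P.center S j.1 j.2 ≤ x j.1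
    · have hS : S j = false := by simpa [hc] using h
      rw [hS, abs_of_nonneg (sub_nonneg.2 hc), abs_of_nonneg]
      · simp; ring
      · simp; linarith
    · have hS : S j = true := by simpa [hc] using h
      push Not at hc
      rw [hS, abs_of_neg (sub_neg.2 hc), abs_of_nonpos]
      · simp; ring
      · simp; linarith
  rw [piece, cap, h]

theorem continuous_piece (S : Fin n × Fin M → Bool) (δ : Fin n × Fin M → ℝ)
    (j : Fin n × Fin M) : Continuous (P.piece S δ j) := by
  unfold piece; fun_prop

theorem convexOn_piece (S : Fin n × Fin M → Bool) (δ : Fin n × Fin M → ℝ) (j : Fin n × Fin M)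
    {x y : Fin n → ℝ} {a b : ℝ} (ha : 0 ≤ a) (hb : 0 ≤ b) (hab : a + b = 1) :
    P.piece S δ j (a • x + b • y) ≤ a * P.piece S δ j x + b * P.piece S δ j y := by
  unfold piece
  set c := P.center S j.1 (j.2 + 1)
  have h : |(a • x + b • y) j.1 - c| ≤ a * |x j.1 - c| + b * |y j.1 - c| := by
    have : (a • x + b • y) j.1 - c = a * (x j.1 - c) + b * (y j.1 - c) := by
      simp only [Pi.add_apply, Pi.smul_apply, smul_eq_mul]
      linear_combination c * hab
    rw [this]
    refine (abs_add_le _ _).trans (le_of_eq ?_)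
    rw [abs_mul, abs_mul, abs_of_nonneg ha, abs_of_nonneg hb]
  have := mul_le_mul_of_nonneg_left h (P.slope_nonneg j.2)
  have h2 : P.offset j.2 + δ j = a * (P.offset j.2 + δ j) + b * (P.offset j.2 + δ j) := by
    rw [← add_mul, hab, one_mul]
  linarith

theorem piece_le_add (S : Fin n × Fin M → Bool) (δ : Fin n × Fin M → ℝ) (j : Fin n × Fin M)
    (x y : Fin n → ℝ) : P.piece S δ j x ≤ P.piece S δ j y + L * ‖x - y‖ := by
  unfold piece
  set c := P.center S j.1 (j.2 + 1)
  have h1 : |x j.1 - c| ≤ |y j.1 - c| + ‖x - y‖ := by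
    have h := norm_le_pi_norm (x - y) j.1
    rw [Pi.sub_apply, Real.norm_eq_abs] at h
    have := abs_sub_le (x j.1) (y j.1) c
    linarith
  have h2 := mul_le_mul_of_nonneg_left h1 (P.slope_nonneg j.2)
  have h3 := mul_le_mul_of_nonneg_right (P.slope_le j.2) (norm_nonneg (x - y))
  linarith

theorem height_le_cap (S : Fin n × Fin M → Bool) {δ : Fin n × Fin M → ℝ}
    (hδ : ∀ j, 0 ≤ δ j ∧ δ j ≤ θ) (j : Fin n × Fin M) (x : Fin n → ℝ) :
    ε + θ ≤ P.cap S δ j x := by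
  have h1 := P.height j.2 j.2.2
  have h2 := mul_nonneg (P.slope_nonneg j.2) (abs_nonneg (x j.1 - P.center S j.1 j.2))
  unfold cap
  linarith [(hδ j).1]

/-! ### Relevant bits and locality -/

variable [NeZero n] [NeZero M]

theorem mem_relevant {S : Fin n × Fin M → Bool} {δ : Fin n × Fin M → ℝ} {x : Fin n → ℝ}
    {j : Fin n × Fin M} : j ∈ P.relevant S δ x ↔ P.value S δ x ≤ P.cap S δ j x := by
  simp [relevant]

theorem piece_le_value (S : Fin n × Fin M → Bool) (δ : Fin n × Fin M → ℝ) (j : Fin n × Fin M)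
    (x : Fin n → ℝ) : P.piece S δ j x ≤ P.value S δ x :=
  Finset.le_sup' (fun j => P.piece S δ j x) (Finset.mem_univ j)

theorem exists_piece_eq_value (S : Fin n × Fin M → Bool) (δ : Fin n × Fin M → ℝ)
    (x : Fin n → ℝ) : ∃ j, P.piece S δ j x = P.value S δ x := by
  obtain ⟨j, -, hj⟩ := Finset.exists_mem_eq_sup' Finset.univ_nonempty fun j => P.piece S δ j x
  exact ⟨j, hj.symm⟩

theorem value_mem (S : Fin n × Fin M → Bool) (δ : Fin n × Fin M → ℝ) :
    (fun x : Box n R => P.value S δ x) ∈ lipschitzConvex n L R := by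
  refine ⟨P.value S δ, ⟨convex_closedBall _ _, ?_⟩, ?_, rfl⟩
  · intro x _ y _ a b ha hb hab
    refine Finset.sup'_le _ _ fun j _ => (P.convexOn_piece S δ j ha hb hab).trans ?_
    exact add_le_add (mul_le_mul_of_nonneg_left (P.piece_le_value S δ j x) ha)
      (mul_le_mul_of_nonneg_left (P.piece_le_value S δ j y) hb)
  · have h : ∀ x y : Fin n → ℝ, P.value S δ x ≤ P.value S δ y + L * ‖x - y‖ := fun x y =>
      Finset.sup'_le _ _ fun j _ => (P.piece_le_add S δ j x y).trans
        (add_le_add_left (P.piece_le_value S δ j y) _)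
    intro x _ y _
    have h1 := h x y
    have h2 := h y x
    rw [norm_sub_rev] at h2
    rw [abs_le]
    constructor <;> linarith

/-- The hard instance as a member of the family. -/
def inst (S : Fin n × Fin M → Bool) (δ : Fin n × Fin M → ℝ) : lipschitzConvex n L R :=
  ⟨_, P.value_mem S δ⟩

theorem value_eventuallyEq {S S' : Fin n × Fin M → Bool} {δ δ' : Fin n × Fin M → ℝ}
    (x : Box n R) (s : Set (Fin n × Fin M))
    (h : ∀ j ∈ s, P.piece S δ j = P.piece S' δ' j)
    (h1 : ∀ j ∉ s, P.piece S δ j x < P.value S δ x)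
    (h2 : ∀ j ∉ s, P.piece S' δ' j x < P.value S' δ' x) :
    (P.inst S δ : Box n R → ℝ) =ᶠ[𝓝 x] (P.inst S' δ' : Box n R → ℝ) :=
  sup'_eventuallyEq (u := fun j (y : Box n R) => P.piece S δ j y)
    (v := fun j (y : Box n R) => P.piece S' δ' j y)
    (fun j => (P.continuous_piece S δ j).comp continuous_subtype_val)
    (fun j => (P.continuous_piece S' δ' j).comp continuous_subtype_val) x s
    (fun j hj => by simp only [h j hj]) h1 h2

/-- Relevance passes to the previous level of the same coordinate. -/
theorem le_cap_pred {S : Fin n × Fin M → Bool} {δ : Fin n × Fin M → ℝ}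
    (hδ : ∀ j, 0 ≤ δ j ∧ δ j ≤ θ) {x : Fin n → ℝ} {i : Fin n} {k : ℕ} (hk : k + 1 < M)
    (h : P.value S δ x ≤ P.cap S δ (i, ⟨k + 1, hk⟩) x) :
    P.value S δ x ≤ P.cap S δ (i, ⟨k, by omega⟩) x := by
  have hg := P.gap k hk
  have hp := P.piece_le_value S δ (i, ⟨k, by omega⟩) x
  have hd := hδ (i, ⟨k + 1, hk⟩)
  have hd' := hδ (i, ⟨k, by omega⟩)
  simp only [piece, cap] at *
  set a := |x i - P.center S i (k + 1)|
  -- Farther out, `gap` and the decreasing slopes put the piece of level `k` strictly above the cap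
  -- of level `k + 1`, even after perturbations in `[0, θ]`, so level `k + 1` would be irrelevant.
  -- Within this distance, `gap` compares the two caps directly.
  have ha : a ≤ P.step k := by
    by_contra hc
    push Not at hc
    have := mul_le_mul_of_nonneg_left hc.le (sub_nonneg.2 (P.slope_anti k))
    linarith
  have h1 := mul_le_mul_of_nonneg_left ha (P.slope_nonneg (k + 1))
  have h2 := mul_nonneg (P.slope_nonneg k) (abs_nonneg (x i - P.center S i k))
  linarith

/-- A kink depends on all lower bits of its coordinate. Since these are relevant too, the piece of a
relevant bit is a function of relevant bits alone. -/
theorem mem_relevant_of_le {S : Fin n × Fin M → Bool} {δ : Fin n × Fin M → ℝ}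
    (hδ : ∀ j, 0 ≤ δ j ∧ δ j ≤ θ) {x : Fin n → ℝ} {i : Fin n} {k l : Fin M} (hlk : l ≤ k)
    (h : (i, k) ∈ P.relevant S δ x) : (i, l) ∈ P.relevant S δ x := by
  simp only [mem_relevant] at *
  obtain ⟨k, hk⟩ := k
  obtain ⟨l, hl⟩ := l
  simp only [Fin.mk_le_mk] at hlk
  induction k, hlk using Nat.le_induction with
  | base => exact h
  | succ k _ ih => exact ih (by omega) (P.le_cap_pred hδ hk h)

theorem mem_relevant_of_eq {S : Fin n × Fin M → Bool} {δ : Fin n × Fin M → ℝ} {x : Fin n → ℝ}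
    {j : Fin n × Fin M} (h : P.piece S δ j x = P.value S δ x) : j ∈ P.relevant S δ x := by
  rw [mem_relevant]
  exact h ▸ P.piece_le_cap S δ j x

/-- The relevant bits determine the instance near `x`. -/
theorem relevant_local {Ans : Type*} {O : lipschitzConvex n L R → Box n R → Ans}
    (hO : IsLocalOracle O) {δ : Fin n × Fin M → ℝ} (hδ : ∀ j, 0 ≤ δ j ∧ δ j ≤ θ) (x : Box n R)
    (S S' : Fin n × Fin M → Bool)
    (h : ∀ j ∈ P.relevant S δ x, j ∈ P.relevant S' δ x →
      S j = S' j ∨ (j ∈ P.wrong S x ↔ j ∈ P.wrong S' x)) :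
    P.relevant S δ x = P.relevant S' δ x ∧ (∀ j ∈ P.relevant S δ x, S j = S' j) ∧
      O (P.inst S δ) x = O (P.inst S' δ) x := by
  -- Induction on the level for the string with the larger value: equal lower bits give equal
  -- centers and hence equal caps, so relevance passes to the smaller value; with equal centers,
  -- equal wrongness means equal bits.
  have aux : ∀ S S' : Fin n × Fin M → Bool, P.value S' δ x ≤ P.value S δ x →
      (∀ j ∈ P.relevant S δ x, j ∈ P.relevant S' δ x →
        S j = S' j ∨ (j ∈ P.wrong S x ↔ j ∈ P.wrong S' x)) →
      ∀ i, ∀ k : Fin M, (i, k) ∈ P.relevant S δ x →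
        (i, k) ∈ P.relevant S' δ x ∧ S (i, k) = S' (i, k) := by
    intro S S' hv h i k
    induction k using WellFoundedLT.induction with
    | _ k ih =>
    intro hk
    have hc : P.center S i k = P.center S' i k := P.center_congr fun l hl =>
      (ih l hl (P.mem_relevant_of_le hδ (le_of_lt hl) hk)).2
    have hk' : (i, k) ∈ P.relevant S' δ x := by
      rw [mem_relevant] at hk ⊢
      simp only [cap] at hk ⊢
      rw [← hc]
      exact hv.trans hk
    refine ⟨hk', ?_⟩
    rcases h (i, k) hk hk' with h | h
    · exact h
    · simp only [mem_wrong, hc] at h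
      generalize decide (P.center S' i k ≤ x.1 i) = g at h
      generalize S (i, k) = p at h ⊢
      generalize S' (i, k) = q at h ⊢
      revert p q g; decide
  have piece_congr : ∀ S S' : Fin n × Fin M → Bool,
      (∀ j ∈ P.relevant S δ x, S j = S' j) →
      ∀ j ∈ P.relevant S δ x, P.piece S δ j = P.piece S' δ j := by
    rintro S S' h ⟨i, k⟩ hj
    funext y
    simp only [piece]
    rw [P.center_congr (S := S) (S' := S') fun l hl =>
      h (i, l) (P.mem_relevant_of_le hδ (Fin.le_def.2 (Nat.lt_succ_iff.1 hl)) hj)]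
  have value_le : ∀ S S' : Fin n × Fin M → Bool,
      (∀ j ∈ P.relevant S δ x, S j = S' j) → P.value S δ x ≤ P.value S' δ x := by
    intro S S' h
    obtain ⟨j, hj⟩ := P.exists_piece_eq_value S δ x
    rw [← hj, piece_congr S S' h j (P.mem_relevant_of_eq hj)]
    exact P.piece_le_value S' δ j x
  have main : ∀ S S' : Fin n × Fin M → Bool, P.value S' δ x ≤ P.value S δ x →
      (∀ j ∈ P.relevant S δ x, j ∈ P.relevant S' δ x →
        S j = S' j ∨ (j ∈ P.wrong S x ↔ j ∈ P.wrong S' x)) →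
      P.relevant S δ x = P.relevant S' δ x ∧ (∀ j ∈ P.relevant S δ x, S j = S' j) ∧
        O (P.inst S δ) x = O (P.inst S' δ) x := by
    intro S S' hv h
    have h1 := fun (j : Fin n × Fin M) hj => aux S S' hv h j.1 j.2 hj
    -- The maximum is attained by a relevant piece, and that piece is shared by both instances. So
    -- the values coincide and `aux` applies in the other direction as well.
    have hv' := value_le S S' fun j hj => (h1 j hj).2
    have h2 := fun (j : Fin n × Fin M) hj => aux S' S hv'
      (fun j hj hj' => (h j hj' hj).imp Eq.symm Iff.symm) j.1 j.2 hj
    have hE : P.relevant S δ x = P.relevant S' δ x :=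
      Finset.Subset.antisymm (fun j hj => (h1 j hj).1) (fun j hj => (h2 j hj).1)
    refine ⟨hE, fun j hj => (h1 j hj).2, hO _ _ _ ?_⟩
    refine P.value_eventuallyEq x (P.relevant S δ x)
      (piece_congr S S' fun j hj => (h1 j hj).2) ?_ ?_
    · exact fun j hj => (P.piece_le_value S δ j x).lt_of_ne
        fun he => hj (P.mem_relevant_of_eq he)
    · exact fun j hj => (P.piece_le_value S' δ j x).lt_of_ne
        fun he => hj (hE ▸ P.mem_relevant_of_eq he)
  rcases le_total (P.value S' δ x) (P.value S δ x) with hv | hv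
  · exact main S S' hv h
  · obtain ⟨e1, e2, e3⟩ := main S' S hv fun j hj hj' => (h j hj' hj).imp Eq.symm Iff.symm
    exact ⟨e1.symm, fun j hj => (e2 j (e1 ▸ hj)).symm, e3.symm⟩

/-- The vector of final kinks is a test point in the box: by `bottom` every piece is at most its
perturbation there, so the minimum is at most `θ`. -/
theorem value_lt_of_isEpsMin {S : Fin n × Fin M → Bool} {δ : Fin n × Fin M → ℝ}
    (hR : 0 ≤ R) (hδ : ∀ j, 0 ≤ δ j ∧ δ j ≤ θ) {x : Box n R}
    (h : IsEpsMin (P.inst S δ : Box n R → ℝ) ε x) : P.value S δ x < ε + θ := by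
  obtain ⟨m, hm, hx⟩ := h
  obtain ⟨M', rfl⟩ : ∃ M', M = M' + 1 := Nat.exists_eq_succ_of_ne_zero (NeZero.ne M)
  have hc : (fun i => P.center S i (M' + 1)) ∈ Box n R := by
    rw [mem_closedBall_zero_iff, pi_norm_le_iff_of_nonneg hR]
    exact fun i => P.abs_center_le S i M'
  have h1 : m ≤ P.value S δ fun i => P.center S i (M' + 1) := hm.2 ⟨⟨_, hc⟩, rfl⟩
  have h2 : P.value S δ (fun i => P.center S i (M' + 1)) ≤ θ := by
    refine Finset.sup'_le _ _ fun j _ => ?_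
    simp only [piece]
    have hj : (j.2 : ℕ) ≤ M' := Nat.lt_succ_iff.1 j.2.2
    have h3 := P.abs_center_sub_le S j.1 j.2 (M' - j.2)
    rw [show (j.2 : ℕ) + 1 + (M' - j.2) = M' + 1 by omega] at h3
    have h4 := h3.trans (sub_le_self _ (P.tail_nonneg _))
    have h5 := mul_le_mul_of_nonneg_left h4 (P.slope_nonneg j.2)
    linarith [P.bottom j.2 j.2.2, (hδ j).2]
  change P.value S δ x < m + ε at hx
  linarith

end Ladder

/-! ### Random perturbations and ties -/

namespace Ladder

variable {n M : ℕ} {L R ε θ : ℝ} (P : Ladder M L R ε θ)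

/-- The perturbation of the pieces, given by multiples of `θ / K`. -/
def perturb {J : Type*} (θ : ℝ) {K : ℕ} (D : J → Fin K) (j : J) : ℝ := θ * (D j : ℕ) / K

theorem perturb_mem {J : Type*} (hθ : 0 ≤ θ) {K : ℕ} (D : J → Fin K) (j : J) :
    0 ≤ perturb θ D j ∧ perturb θ D j ≤ θ := by
  have hK : (0 : ℝ) < K := by exact_mod_cast (D j).pos
  refine ⟨by unfold perturb; positivity, ?_⟩
  rw [perturb, div_le_iff₀ hK]
  exact mul_le_mul_of_nonneg_left (by exact_mod_cast (D j).2.le) hθ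

theorem perturb_lt {J : Type*} (hθ : 0 < θ) {K : ℕ} {D D' : J → Fin K} {j : J}
    (h : D j < D' j) : perturb θ D j < perturb θ D' j := by
  have hK : (0 : ℝ) < K := by exact_mod_cast (D j).pos
  unfold perturb
  gcongr
  exact_mod_cast h

variable [NeZero n] [NeZero M] {Ans : Type*} (O : lipschitzConvex n L R → Box n R → Ans)
  (z : List Ans → Box n R)

/-- At step `t` two pieces attain the maximum, one of which, `j`, did not attain it before. -/
def IsTie (S : Fin n × Fin M → Bool) (δ : Fin n × Fin M → ℝ) (t : ℕ) (j : Fin n × Fin M) : Prop :=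
  (∀ s < t, P.piece S δ j (probeAt z (O (P.inst S δ)) s : Box n R) <
    P.value S δ (probeAt z (O (P.inst S δ)) s : Box n R)) ∧
  P.piece S δ j (probeAt z (O (P.inst S δ)) t : Box n R) = P.value S δ (probeAt z (O (P.inst S δ)) t : Box n R) ∧
  ∃ i ≠ j, P.piece S δ i (probeAt z (O (P.inst S δ)) t : Box n R) =
    P.value S δ (probeAt z (O (P.inst S δ)) t : Box n R)

variable {O}

/-- Before step `t` the piece `j` is inactive under both perturbations, so changing `δ j` leaves the
transcript and the `t`-th point unchanged. There the larger perturbation lifts piece `j` strictly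
above all others, which excludes a tie. -/
theorem not_isTie_of_lt (hO : IsLocalOracle O) {S : Fin n × Fin M → Bool}
    {δ δ' : Fin n × Fin M → ℝ} {t : ℕ} {j : Fin n × Fin M} (hoff : ∀ i ≠ j, δ i = δ' i)
    (hlt : δ j < δ' j) (h : P.IsTie O z S δ t j) (h' : P.IsTie O z S δ' t j) : False := by
  have htr : ∀ s ≤ t, Algorithm.transcript z (O (P.inst S δ)) s =
      Algorithm.transcript z (O (P.inst S δ')) s := by
    intro s
    induction s with
    | zero => intro _; rfl
    | succ s ih =>
      intro hs
      have ih := ih (by omega)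
      have h1 := h.1 s hs
      have h2 := h'.1 s hs
      simp only [Algorithm.transcript]
      simp only [probeAt] at h1 h2
      rw [← ih] at h2 ⊢
      congr 2
      refine hO _ _ _ (P.value_eventuallyEq _ {i | i ≠ j} ?_ ?_ ?_)
      · intro i hi
        funext y
        simp only [piece, hoff i hi]
      · intro i hi
        rw [Set.mem_ofPred_eq, not_not] at hi
        exact hi ▸ h1
      · intro i hi
        rw [Set.mem_ofPred_eq, not_not] at hi
        exact hi ▸ h2
  obtain ⟨-, hj, -⟩ := h
  obtain ⟨-, hj', i, hi, hii⟩ := h'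
  simp only [probeAt, ← htr t le_rfl] at hj hj' hii
  have h1 := P.piece_le_value S δ i (z (Algorithm.transcript z (O (P.inst S δ)) t))
  simp only [piece] at h1 hj hj' hii
  linarith [hoff i hi]

/-- Fresh mistakes are maximizers now and were not maximizers before, since a maximizer is relevant
and would have been explored. Two of them would form a tie. -/
theorem card_freshMistakes_le {S : Fin n × Fin M → Bool} {δ : Fin n × Fin M → ℝ} {t : ℕ}
    (h : ∀ j, ¬ P.IsTie O z S δ t j) :
    (freshMistakes z (O (P.inst S δ)) (fun x => P.relevant S δ x) (fun x => P.wrong S x) t).card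
      ≤ 1 := by
  have hmax : ∀ j ∈ freshMistakes z (O (P.inst S δ)) (fun x => P.relevant S δ x)
      (fun x => P.wrong S x) t, P.piece S δ j (probeAt z (O (P.inst S δ)) t : Box n R) =
        P.value S δ (probeAt z (O (P.inst S δ)) t : Box n R) := by
    intro j hj
    obtain ⟨⟨h1, h2⟩, -⟩ := mem_freshMistakes.1 hj
    refine le_antisymm (P.piece_le_value S δ j _) ?_
    rw [P.piece_eq_cap δ h2]
    exact P.mem_relevant.1 h1
  refine Finset.card_le_one.2 fun i hi j hj => ?_
  by_contra hij
  refine h j ⟨fun s hs => (P.piece_le_value S δ j _).lt_of_ne fun he => ?_, hmax j hj, i, hij,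
    hmax i hi⟩
  exact (mem_freshMistakes.1 hj).2 (mem_explored.2 ⟨s, hs, P.mem_relevant_of_eq he⟩)

open Classical in
/-- For most of the hard instances no strategy probes an `ε`-minimum within few steps. -/
theorem card_solved_le (hO : IsLocalOracle O) (hR : 0 ≤ R) (hθ : 0 < θ) (T K : ℕ)
    (hT : 8 * T ≤ n * M) (hK : 0 < K) :
    (((Finset.univ : Finset ((Fin n × Fin M → Bool) × (Fin n × Fin M → Fin K))).filter fun ω =>
      ∃ t ≤ T, IsEpsMin (P.inst ω.1 (perturb θ ω.2) : Box n R → ℝ) ε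
        (probeAt z (O (P.inst ω.1 (perturb θ ω.2))) t)).card : ℝ) ≤
      ((3 / 4) ^ (n * M) + (T + 1) * (n * M) / K) *
        Fintype.card ((Fin n × Fin M → Bool) × (Fin n × Fin M → Fin K)) := by
  set Ω := (Fin n × Fin M → Bool) × (Fin n × Fin M → Fin K)
  set A := (Finset.univ : Finset Ω).filter fun ω =>
    ∃ t ≤ T, IsEpsMin (P.inst ω.1 (perturb θ ω.2) : Box n R → ℝ) ε
      (probeAt z (O (P.inst ω.1 (perturb θ ω.2))) t)
  have hK' : (0 : ℝ) < K := by exact_mod_cast hK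
  let B : ℕ × (Fin n × Fin M) → Finset Ω := fun q =>
    Finset.univ.filter fun ω => P.IsTie O z ω.1 (perturb θ ω.2) q.1 q.2
  let I : Finset (ℕ × (Fin n × Fin M)) := Finset.range (T + 1) ×ˢ Finset.univ
  -- With the other coordinates fixed, at most one of the `K` values of the perturbation of piece
  -- `q.2` produces a tie at step `q.1`.
  have hB : ∀ q, ((B q).card : ℝ) ≤ Fintype.card Ω / K := by
    intro q
    rw [le_div_iff₀ hK']
    have := card_mul_le_of_update (B q) q.2 (by
      intro S D a h1 h2
      simp only [B, Finset.mem_filter, Finset.mem_univ, true_and] at h1 h2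
      have hne : ∀ i ≠ q.2, perturb θ D i = perturb θ (Function.update D q.2 a) i := by
        intro i hi
        simp [perturb, hi]
      by_contra hne'
      rcases lt_or_gt_of_ne hne' with hlt | hlt
      · exact P.not_isTie_of_lt z hO (fun i hi => (hne i hi).symm)
          (perturb_lt hθ (by simpa using hlt)) h2 h1
      · exact P.not_isTie_of_lt z hO hne (perturb_lt hθ (by simpa using hlt)) h1 h2)
    exact_mod_cast this
  have htie : ((I.biUnion B).card : ℝ) ≤ (T + 1) * (n * M) / K * Fintype.card Ω := by
    calc ((I.biUnion B).card : ℝ) ≤ ∑ q ∈ I, ((B q).card : ℝ) := by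
          exact_mod_cast Finset.card_biUnion_le
      _ ≤ ∑ q ∈ I, (Fintype.card Ω / K : ℝ) := Finset.sum_le_sum fun q _ => hB q
      _ = (T + 1) * (n * M) / K * Fintype.card Ω := by
          simp only [Finset.sum_const, I, Finset.card_product, Finset.card_range,
            Finset.card_univ, Fintype.card_prod, Fintype.card_fin, nsmul_eq_mul]
          push_cast
          ring
  -- Away from ties the perturbation is frozen, and the encoding bound counts the strings in each
  -- fibre.
  have hrest : ((A \ I.biUnion B).card : ℝ) ≤ (3 / 4) ^ (n * M) * Fintype.card Ω := by
    have h1 : (A \ I.biUnion B).card ≤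
        ((Finset.univ : Finset (Finset (Fin n × Fin M))).filter fun V => V.card ≤ T).card *
          (Finset.univ : Finset (Fin n × Fin M → Fin K)).card := by
      refine Finset.card_le_mul_card_image_of_maps_to (f := Prod.snd)
        (fun _ _ => Finset.mem_univ _) _ fun D _ => ?_
      have hδ := perturb_mem hθ.le D
      rw [← Finset.card_image_of_injOn (f := Prod.fst) (by
        rintro ⟨S, D₁⟩ h1 ⟨S', D₂⟩ h2 rfl
        simp only [Finset.coe_filter, Set.mem_ofPred_eq] at h1 h2
        rw [h1.2, h2.2])]
      refine card_explored_le z (fun S => O (P.inst S (perturb θ D)))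
        (fun S x => P.relevant S (perturb θ D) x) (fun S x => P.wrong S x)
        (fun x S S' h => P.relevant_local hO hδ x S S' h) T _ ?_ ?_
      · intro S hS t ht
        simp only [Finset.mem_image, Finset.mem_filter, Finset.mem_sdiff, Finset.mem_biUnion] at hS
        obtain ⟨⟨S₁, D₁⟩, ⟨⟨-, hS⟩, rfl⟩, rfl⟩ := hS
        refine P.card_freshMistakes_le z fun j hj => hS ⟨(t, j), ?_, ?_⟩
        · simp only [I, Finset.mem_product, Finset.mem_range, Finset.mem_univ, and_true]
          omega
        · simpa [B] using hj
      · intro S hS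
        simp only [Finset.mem_image, Finset.mem_filter, Finset.mem_sdiff,
          Prod.exists] at hS
        obtain ⟨S₁, D₁, ⟨⟨hS, -⟩, rfl⟩, rfl⟩ := hS
        simp only [A, Finset.mem_filter, Finset.mem_univ, true_and] at hS
        obtain ⟨t, ht, hmin⟩ := hS
        have hlt := P.value_lt_of_isEpsMin hR hδ hmin
        refine ⟨t, ht, ?_, ?_⟩
        -- The value lies below `ε + θ`, hence below every cap: every bit is relevant, and none is
        -- wrong because a wrong one would lift the value to its cap.
        · refine Finset.eq_univ_iff_forall.2 fun j => P.mem_relevant.2 ?_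
          exact hlt.le.trans (P.height_le_cap _ hδ j _)
        · refine Finset.eq_empty_iff_forall_notMem.2 fun j hj => ?_
          have h2 := (mem_freshMistakes.1 hj).1.2
          have h3 := P.piece_le_value S₁ (perturb θ D₁) j
            (probeAt z (O (P.inst S₁ (perturb θ D₁))) t : Box n R)
          rw [P.piece_eq_cap _ h2] at h3
          exact absurd (hlt.trans_le (P.height_le_cap _ hδ j _)) (not_lt.2 h3)
    have h2 := card_small_subsets_le (Fin n × Fin M) T (by simpa using hT)
    have h3 : (Fintype.card Ω : ℝ) = 2 ^ (n * M) *
        (Finset.univ : Finset (Fin n × Fin M → Fin K)).card := by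
      simp [Ω, Fintype.card_prod]
    rw [h3, ← mul_assoc]
    simp only [Fintype.card_prod, Fintype.card_fin] at h2
    refine le_trans (by exact_mod_cast h1) (mul_le_mul_of_nonneg_right h2 (Nat.cast_nonneg _))
  have hsub : A ⊆ (A \ I.biUnion B) ∪ I.biUnion B := by
    rw [Finset.sdiff_union_self_eq_union]
    exact Finset.subset_union_left
  have hcard : (A.card : ℝ) ≤ (A \ I.biUnion B).card + (I.biUnion B).card := by
    exact_mod_cast (Finset.card_le_card hsub).trans (Finset.card_union_le _ _)
  linarith

/-! ### Concrete ladders -/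

/-- One level: the maximum of the coordinates, each with a random sign. -/
def flat (hL : 0 ≤ L) (hR : 0 ≤ R) : Ladder 1 L R ε (L * R - ε) where
  slope _ := L
  step k := if k = 0 then R else 0
  offset _ := 0
  tail _ := 0
  slope_nonneg _ := hL
  slope_le _ := le_rfl
  slope_anti _ := le_rfl
  step_nonneg k := by split_ifs <;> simp [hR]
  tail_nonneg _ := le_rfl
  step_add_tail _ := by simp
  step_zero_add_tail := by simp
  gap k hk := absurd hk (by omega)
  bottom _ _ := by simp
  height k hk := by
    obtain rfl : k = 0 := by omega
    simp

/-- All lengths and slopes shrink by the factor `4` from each level to the next. -/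
def geometric {M : ℕ} (hL : 0 ≤ L) (hR : 0 ≤ R) (hε : 0 < ε) (hM : 16 ^ M * ε ≤ L * R) :
    Ladder M L R ε ε where
  slope k := L / 4 ^ k
  step k := R / 2 / 4 ^ k
  -- This is `-(slope k * tail k)`, which turns `bottom` into an equality; `tail k` is the exact sum
  -- of all later steps.
  offset k := -(L * R / 6 / 16 ^ k)
  tail k := R / 6 / 4 ^ k
  slope_nonneg _ := by positivity
  slope_le k := div_le_self hL (one_le_pow₀ (by norm_num))
  slope_anti k := by gcongr <;> norm_num
  step_nonneg _ := by positivity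
  tail_nonneg _ := by positivity
  step_add_tail k := by rw [pow_succ]; apply le_of_eq; field_simp; ring
  step_zero_add_tail := by norm_num; linarith
  gap k hk := by
    -- In units of `L * R / 16 ^ k` the perturbation bound is at most `1 / 16`, and the claim
    -- becomes `5 / 32 - 1 / 96 + 1 / 16 < 1 / 2 - 1 / 6`.
    have h : 16 * ε ≤ L * R / 16 ^ k := by
      rw [le_div_iff₀ (by positivity)]
      calc 16 * ε * 16 ^ k = 16 ^ (k + 1) * ε := by ring
        _ ≤ 16 ^ M * ε := by gcongr; norm_num
        _ ≤ L * R := hM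
    have e1 : L / 4 ^ (k + 1) * (R / 2 / 4 ^ k + R / 2 / 4 ^ (k + 1)) =
        5 / 32 * (L * R / 16 ^ k) := by
      rw [show (16 : ℝ) = 4 * 4 by norm_num, mul_pow, pow_succ]; field_simp; ring
    have e2 : L / 4 ^ k * (R / 2 / 4 ^ k) = 1 / 2 * (L * R / 16 ^ k) := by
      rw [show (16 : ℝ) = 4 * 4 by norm_num, mul_pow]; field_simp
    have e3 : L * R / 6 / 16 ^ (k + 1) = 1 / 96 * (L * R / 16 ^ k) := by
      rw [pow_succ]; field_simp; ring
    have e4 : L * R / 6 / 16 ^ k = 1 / 6 * (L * R / 16 ^ k) := by ring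
    rw [e1, e2, e3, e4]
    linarith
  bottom k _ := by
    apply le_of_eq
    rw [show (16 : ℝ) = 4 * 4 by norm_num, mul_pow]; field_simp; norm_num
  height k hk := by
    have h : 16 * ε ≤ L * R / 16 ^ k := by
      rw [le_div_iff₀ (by positivity)]
      calc 16 * ε * 16 ^ k = 16 ^ (k + 1) * ε := by ring
        _ ≤ 16 ^ M * ε := by gcongr; norm_num; omega
        _ ≤ L * R := hM
    have e2 : L / 4 ^ k * (R / 2 / 4 ^ k) = 1 / 2 * (L * R / 16 ^ k) := by
      rw [show (16 : ℝ) = 4 * 4 by norm_num, mul_pow]; field_simp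
    have e4 : L * R / 6 / 16 ^ k = 1 / 6 * (L * R / 16 ^ k) := by ring
    rw [e2, e4]
    linarith

end Ladder

/-- A ladder with enough levels. -/
theorem exists_ladder (n : ℕ) {L R ε : ℝ} (hL : 0 < L) (hR : 0 < R) (hε : 0 < ε)
    (h : ε < L * R) : ∃ (M : ℕ) (θ : ℝ), 0 < M ∧ 0 < θ ∧ n * Real.logb 2 (L * R / ε) ≤ 8 * (n * M) ∧
      Nonempty (Ladder M L R ε θ) := by
  have h1 : 1 ≤ L * R / ε := by rw [one_le_div hε]; exact h.le
  obtain ⟨M, hM1, hM2⟩ := exists_nat_pow_near h1 (show (1 : ℝ) < 16 by norm_num)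
  have hlog : Real.logb 2 (L * R / ε) ≤ 4 * (M + 1) := by
    rw [Real.logb_le_iff_le_rpow (by norm_num) (by positivity)]
    refine hM2.le.trans (le_of_eq ?_)
    rw [Real.rpow_mul (by norm_num)]
    norm_cast
  -- For `L * R / ε < 16` the geometric ladder would have no level, so the flat one is used;
  -- otherwise `M + 1 ≤ 2 * M` yields the factor `8`.
  rcases Nat.eq_zero_or_pos M with rfl | hM
  · refine ⟨1, L * R - ε, one_pos, sub_pos.2 h, ?_, ⟨Ladder.flat hL.le hR.le⟩⟩
    have := mul_le_mul_of_nonneg_left hlog (Nat.cast_nonneg (α := ℝ) n)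
    have hn := Nat.cast_nonneg (α := ℝ) n
    push_cast at *
    linarith
  · refine ⟨M, ε, hM, hε, ?_, ⟨Ladder.geometric hL.le hR.le hε ((le_div_iff₀ hε).1 hM1)⟩⟩
    have hM' : (1 : ℝ) ≤ M := by exact_mod_cast hM
    have h2 : Real.logb 2 (L * R / ε) ≤ 8 * M := by linarith
    have := mul_le_mul_of_nonneg_left h2 (Nat.cast_nonneg (α := ℝ) n)
    linarith

/-! ### The finite hard family -/

open Classical in
/-- A finite family of instances, few of which any algorithm solves with few queries. -/
theorem exists_hard_family (n : ℕ) {L R ε : ℝ} (hL : 0 < L) (hR : 0 < R) (hε : 0 < ε)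
    {Ans : Type*} {O : lipschitzConvex n L R → Box n R → Ans} (hO : IsLocalOracle O)
    {N : ℝ} (hN : N = n * Real.logb 2 (L * R / ε)) (hN0 : 0 < N) :
    ∃ (Ω : Type) (_ : Fintype Ω) (_ : Nonempty Ω) (F : Ω → lipschitzConvex n L R),
      ∀ A : Algorithm (Box n R) Ans,
        (((Finset.univ : Finset Ω).filter fun ω =>
          A.Finds (O (F ω)) (F ω) ε ∧ A.numQueries (O (F ω)) < ENNReal.ofReal (N / 64)).card : ℝ) ≤
        min (7 / 8) (56 / N) * Fintype.card Ω := by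
  have hn : 0 < n := by
    rcases Nat.eq_zero_or_pos n with rfl | hn
    · simp at hN; exact absurd hN hN0.ne'
    · exact hn
  have hlt : ε < L * R := by
    by_contra hc
    push Not at hc
    have : Real.logb 2 (L * R / ε) ≤ 0 :=
      Real.logb_nonpos (by norm_num) (by positivity) (by rw [div_le_one hε]; exact hc)
    have := mul_nonpos_of_nonneg_of_nonpos (Nat.cast_nonneg (α := ℝ) n) this
    linarith
  obtain ⟨M, θ, hM, hθ, hNM, ⟨P⟩⟩ := exists_ladder n hL hR hε hlt
  rw [← hN] at hNM
  have : NeZero n := ⟨hn.ne'⟩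
  have : NeZero M := ⟨hM.ne'⟩
  set m := n * M with hm
  have hm0 : 0 < m := Nat.mul_pos hn hM
  set T := m / 8 with hTdef
  -- The grid is fine enough to push the total tie probability below `(1 / 8) ^ m`.
  obtain ⟨K, hK⟩ := exists_nat_gt (((T : ℝ) + 1) * (n * M) * 8 ^ m)
  have hK0 : (0 : ℝ) < K := lt_of_le_of_lt (by positivity) hK
  have : NeZero K := ⟨by rintro rfl; simp at hK0⟩
  refine ⟨(Fin n × Fin M → Bool) × (Fin n × Fin M → Fin K), inferInstance, inferInstance,
    fun ω => P.inst ω.1 (Ladder.perturb θ ω.2), fun A => ?_⟩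
  have hcount := P.card_solved_le A.probe hO hR.le hθ T K (by omega)
    (Nat.pos_of_ne_zero (NeZero.ne K))
  refine le_trans (Nat.cast_le.2 (Finset.card_le_card ?_)) (hcount.trans ?_)
  · intro ω hω
    simp only [Finset.mem_filter, Finset.mem_univ, true_and] at hω ⊢
    obtain ⟨t, ht, hmin⟩ := Algorithm.exists_probe_isEpsMin hω.1 hω.2
    refine ⟨t, ?_, hmin⟩
    -- From `N ≤ 8 * m`, fewer than `N / 64` queries means `8 * t < m`, hence `t ≤ T`.
    rw [← ENNReal.ofReal_natCast, ENNReal.ofReal_lt_ofReal_iff (by positivity)] at ht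
    have h8 : ((8 * t : ℕ) : ℝ) < m := by
      rw [hm]; push_cast; linarith
    have : 8 * t < m := by exact_mod_cast h8
    omega
  · refine mul_le_mul_of_nonneg_right ?_ (Nat.cast_nonneg _)
    have h1 : ((T : ℝ) + 1) * (n * M) / K ≤ (1 / 8) ^ m := by
      rw [div_le_iff₀ hK0, one_div, inv_pow, ← div_eq_inv_mul, le_div_iff₀ (by positivity)]
      exact hK.le
    have h2 : (3 / 4 : ℝ) ^ m + (1 / 8) ^ m ≤ (7 / 8) ^ m := by
      refine (pow_add_pow_le (by norm_num) (by norm_num) hm0.ne').trans (le_of_eq ?_)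
      norm_num
    refine le_trans (add_le_add_right h1 _) (h2.trans (le_min ?_ ?_))
    · exact pow_le_of_le_one (by norm_num) (by norm_num) hm0.ne'
    -- Bernoulli: `(8 / 7) ^ m ≥ 1 + m / 7 ≥ N / 56`.
    · have hb := one_add_mul_le_pow (show (-2 : ℝ) ≤ 1 / 7 by norm_num) m
      have hmN : N ≤ 8 * m := by rw [hm]; push_cast; exact hNM
      have e : (7 / 8 : ℝ) ^ m = ((1 + 1 / 7) ^ m)⁻¹ := by rw [← inv_pow]; norm_num
      rw [e, inv_le_comm₀ (by positivity) (by positivity), inv_div]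
      linarith

/-! ### From counting to complexity bounds -/

/-- Expectation with respect to the image of a uniform distribution. -/
theorem tsum_map_uniformOfFintype {Ω α : Type*} [Fintype Ω] [Nonempty Ω] (F : Ω → α)
    (g : α → ℝ≥0∞) :
    ∑' a, (PMF.uniformOfFintype Ω).map F a * g a =
      ∑ ω, (Fintype.card Ω : ℝ≥0∞)⁻¹ * g (F ω) := by
  classical
  simp only [PMF.map_apply, PMF.uniformOfFintype_apply]
  calc ∑' a, (∑' ω, if a = F ω then (Fintype.card Ω : ℝ≥0∞)⁻¹ else 0) * g a
      = ∑' a, ∑' ω, if a = F ω then (Fintype.card Ω : ℝ≥0∞)⁻¹ * g a else 0 := by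
        refine tsum_congr fun a => ?_
        rw [← ENNReal.tsum_mul_right]
        exact tsum_congr fun ω => by rw [ite_mul, zero_mul]
    _ = ∑' ω, ∑' a, if a = F ω then (Fintype.card Ω : ℝ≥0∞)⁻¹ * g a else 0 := ENNReal.tsum_comm
    _ = ∑ ω, (Fintype.card Ω : ℝ≥0∞)⁻¹ * g (F ω) := by
        rw [tsum_fintype]
        exact Finset.sum_congr rfl fun ω _ => tsum_ite_eq _ _

section HardDistribution

variable {X Ans : Type*} {𝓕 : Set (X → ℝ)} {O : 𝓕 → X → Ans} {ε : ℝ} {Ω : Type*} [Fintype Ω]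
  [Nonempty Ω] {F : Ω → 𝓕} {τ : ℝ≥0∞} {η : ℝ}

-- The counting bound for one algorithm, written with an indicator evaluated at `A` so that it can
-- be integrated over the law of a randomized algorithm.
open Classical in
theorem sum_indicator_le
    (hF : ∀ A : Algorithm X Ans, (((Finset.univ : Finset Ω).filter fun ω =>
      A.Finds (O (F ω)) (F ω) ε ∧ A.numQueries (O (F ω)) < τ).card : ℝ) ≤ η * Fintype.card Ω)
    (A : Algorithm X Ans) :
    ∑ ω, (Fintype.card Ω : ℝ≥0∞)⁻¹ *
      {A : Algorithm X Ans | A.Finds (O (F ω)) (F ω) ε ∧ A.numQueries (O (F ω)) < τ}.indicator 1 A ≤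
      ENNReal.ofReal η := by
  have hc : (0 : ℝ) < Fintype.card Ω := by exact_mod_cast Fintype.card_pos
  rw [← Finset.mul_sum, mul_comm, ← div_eq_mul_inv]
  refine ENNReal.div_le_of_le_mul ?_
  have h1 : ∑ ω, {A : Algorithm X Ans | A.Finds (O (F ω)) (F ω) ε ∧
      A.numQueries (O (F ω)) < τ}.indicator (1 : Algorithm X Ans → ℝ≥0∞) A =
      ((Finset.univ : Finset Ω).filter fun ω =>
        A.Finds (O (F ω)) (F ω) ε ∧ A.numQueries (O (F ω)) < τ).card := by
    rw [Finset.card_filter, Nat.cast_sum]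
    refine Finset.sum_congr rfl fun ω _ => ?_
    simp [Set.indicator_apply]
  rw [h1, ← ENNReal.ofReal_natCast, ← ENNReal.ofReal_natCast,
    ← ENNReal.ofReal_mul' hc.le]
  exact ENNReal.ofReal_le_ofReal (hF A)

open Classical in
theorem one_le_toOuterMeasure_add
    (hF : ∀ A : Algorithm X Ans, (((Finset.univ : Finset Ω).filter fun ω =>
      A.Finds (O (F ω)) (F ω) ε ∧ A.numQueries (O (F ω)) < τ).card : ℝ) ≤ η * Fintype.card Ω)
    (A : Algorithm X Ans) :
    1 ≤ ((PMF.uniformOfFintype Ω).map F).toOuterMeasure {f | τ ≤ A.solveTime (O f) f ε} +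
      ENNReal.ofReal η := by
  set p := (PMF.uniformOfFintype Ω).map F
  have h1 := sum_indicator_le hF A
  rw [← tsum_map_uniformOfFintype F fun f : 𝓕 =>
    {A : Algorithm X Ans | A.Finds (O f) f ε ∧ A.numQueries (O f) < τ}.indicator 1 A] at h1
  refine le_trans ?_ (add_le_add_right h1 _)
  rw [PMF.toOuterMeasure_apply, ← ENNReal.tsum_add, ← p.tsum_coe]
  refine ENNReal.tsum_le_tsum fun f => ?_
  by_cases h : τ ≤ A.solveTime (O f) f ε
  · rw [Set.indicator_of_mem (by exact h)]
    exact le_self_add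
  · have h' : A.Finds (O f) f ε ∧ A.numQueries (O f) < τ := by
      unfold Algorithm.solveTime at h
      split_ifs at h with hf
      · exact ⟨hf, not_le.1 h⟩
      · simp at h
    rw [Set.indicator_of_mem (s := {A : Algorithm X Ans | _}) (by exact h')]
    simp [p]

-- Every run asks many queries, fails, or succeeds quickly. The last event has average probability
-- at most `η` by exchanging the sum over instances with the integral over the coins.
open Classical in
theorem one_le_errorProb_add
    (hF : ∀ A : Algorithm X Ans, (((Finset.univ : Finset Ω).filter fun ω =>
      A.Finds (O (F ω)) (F ω) ε ∧ A.numQueries (O (F ω)) < τ).card : ℝ) ≤ η * Fintype.card Ω)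
    (B : RandomizedAlgorithm O ε) :
    1 ≤ B.probQueriesGE ((PMF.uniformOfFintype Ω).map F) τ +
      B.errorProb ((PMF.uniformOfFintype Ω).map F) + ENNReal.ofReal η := by
  let _ := B.mAlg
  have := B.isProb
  set p := (PMF.uniformOfFintype Ω).map F
  have hmeas : ∀ f : 𝓕, MeasurableSet
      {A : Algorithm X Ans | A.Finds (O f) f ε ∧ A.numQueries (O f) < τ} := fun f =>
    (B.measurableSet_finds f).inter (measurableSet_lt (B.measurable_numQueries f) measurable_const)
  have h1 : ∑' f : 𝓕, p f *
      B.law {A | A.Finds (O f) f ε ∧ A.numQueries (O f) < τ} ≤ ENNReal.ofReal η := by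
    rw [tsum_map_uniformOfFintype F fun f : 𝓕 =>
      B.law {A | A.Finds (O f) f ε ∧ A.numQueries (O f) < τ}]
    calc _ = ∑ ω, ∫⁻ A, (Fintype.card Ω : ℝ≥0∞)⁻¹ * {A : Algorithm X Ans |
            A.Finds (O (F ω)) (F ω) ε ∧ A.numQueries (O (F ω)) < τ}.indicator 1 A ∂B.law := by
          refine Finset.sum_congr rfl fun ω _ => ?_
          rw [lintegral_const_mul _ (measurable_one.indicator (hmeas _)),
            lintegral_indicator_one (hmeas _)]
      _ = ∫⁻ A, ∑ ω, (Fintype.card Ω : ℝ≥0∞)⁻¹ * {A : Algorithm X Ans |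
            A.Finds (O (F ω)) (F ω) ε ∧ A.numQueries (O (F ω)) < τ}.indicator 1 A ∂B.law := by
          rw [lintegral_finsetSum]
          exact fun ω _ => (measurable_one.indicator (hmeas _)).const_mul _
      _ ≤ ∫⁻ _, ENNReal.ofReal η ∂B.law := lintegral_mono fun A => sum_indicator_le hF A
      _ = ENNReal.ofReal η := by simp
  refine le_trans ?_ (add_le_add_right h1 _)
  rw [RandomizedAlgorithm.probQueriesGE, RandomizedAlgorithm.errorProb, ← ENNReal.tsum_add,
    ← ENNReal.tsum_add, ← p.tsum_coe]
  refine ENNReal.tsum_le_tsum fun f => ?_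
  rw [← mul_add, ← mul_add]
  refine le_mul_of_one_le_right zero_le ?_
  rw [← measure_univ (μ := B.law)]
  refine le_trans (measure_mono ?_) ((measure_union_le _ _).trans
    (add_le_add_left (measure_union_le _ _) _))
  intro A _
  by_cases h1 : τ ≤ A.numQueries (O f)
  · exact Or.inl (Or.inl h1)
  · by_cases h2 : A.Finds (O f) f ε
    · exact Or.inr ⟨h2, not_le.1 h1⟩
    · exact Or.inl (Or.inr h2)

theorem mul_toOuterMeasure_le (p : PMF 𝓕) (A : Algorithm X Ans) (τ : ℝ≥0∞) :
    τ * p.toOuterMeasure {f | τ ≤ A.solveTime (O f) f ε} ≤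
      ∑' f : 𝓕, p f * A.solveTime (O f) f ε := by
  rw [PMF.toOuterMeasure_apply, ← ENNReal.tsum_mul_left]
  refine ENNReal.tsum_le_tsum fun f => ?_
  by_cases h : τ ≤ A.solveTime (O f) f ε
  · rw [Set.indicator_of_mem (by exact h), mul_comm]
    exact mul_le_mul_right h _
  · rw [Set.indicator_of_notMem (by exact h), mul_zero]
    exact zero_le

theorem mul_probQueriesGE_le (p : PMF 𝓕) (B : RandomizedAlgorithm O ε) (τ : ℝ≥0∞) :
    τ * B.probQueriesGE p τ ≤ B.expectedQueries p := by
  let _ := B.mAlg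
  rw [RandomizedAlgorithm.probQueriesGE, ← ENNReal.tsum_mul_left]
  refine ENNReal.tsum_le_tsum fun f => ?_
  rw [mul_left_comm]
  exact mul_le_mul_right (mul_meas_ge_le_lintegral (B.measurable_numQueries f) τ) _

end HardDistribution

end

theorem theorem6p4 :
    ∃ (c C : ℝ) (η : ℝ → ℝ), 0 < c ∧ Tendsto η atTop (𝓝 0) ∧
      ∀ (n : ℕ) (L R ε : ℝ), 0 < L → 0 < R → 0 < ε →
      ∀ (Ans : Type*) (O : lipschitzConvex n L R → Box n R → Ans), IsLocalOracle O →
      ∀ N : ℝ, N = n * Real.logb 2 (L * R / ε) →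
        ENNReal.ofReal (c * N) ≤ complexityD O ε ∧
        ENNReal.ofReal (c * N) ≤ complexityHP O ε (η N) ∧
        ∀ Pe : ℝ, 0 ≤ Pe → Pe ≤ 1 →
          (C ≤ (1 - Pe) * N →
            ENNReal.ofReal (c * ((1 - Pe) * N)) ≤ complexityDBounded O ε Pe) ∧
          ENNReal.ofReal (c * N) ≤ complexityHPBounded O ε Pe (η N) := by
  -- With threshold `N / 64`, the constant success bound `7 / 8` costs a further factor `8` in the
  -- expectation, giving `1 / 512`. The constant `112` lets half of `(1 - Pe) * N` absorb the loss
  -- `56`; its positivity makes the bounded-error expectation claim vacuous for `N ≤ 0`.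
  refine ⟨1 / 512, 112, fun N => 56 / N, by norm_num, tendsto_const_nhds.div_atTop tendsto_id, ?_⟩
  intro n L R ε hL hR hε Ans O hO N hN
  rcases le_or_gt N 0 with hN0 | hN0
  · have h0 : ENNReal.ofReal (1 / 512 * N) = 0 := ENNReal.ofReal_of_nonpos (by linarith)
    refine ⟨h0 ▸ zero_le, h0 ▸ zero_le, fun Pe _ hPe => ⟨fun hC => ?_, h0 ▸ zero_le⟩⟩
    have := mul_nonpos_of_nonneg_of_nonpos (sub_nonneg.2 hPe) hN0
    linarith
  obtain ⟨Ω, _, _, F, hF⟩ := exists_hard_family n hL hR hε hO hN hN0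
  set p := (PMF.uniformOfFintype Ω).map F
  set τ := ENNReal.ofReal (N / 64)
  have hcτ : ENNReal.ofReal (1 / 512 * N) ≤ τ := ENNReal.ofReal_le_ofReal (by linarith)
  have hη0 : 0 ≤ 56 / N := by positivity
  have hmin : ENNReal.ofReal (min (7 / 8) (56 / N)) ≤ ENNReal.ofReal (56 / N) :=
    ENNReal.ofReal_le_ofReal (min_le_right _ _)
  have hB : ∀ (Pe : ℝ), 0 ≤ Pe → ∀ B : RandomizedAlgorithm O ε,
      B.errorProb p ≤ ENNReal.ofReal Pe →
        ENNReal.ofReal (1 - Pe - 56 / N) ≤ B.probQueriesGE p τ := by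
    intro Pe hPe B hB
    rw [ENNReal.ofReal_sub _ hη0, ENNReal.ofReal_sub _ hPe, ENNReal.ofReal_one,
      tsub_le_iff_right, tsub_le_iff_right]
    refine (one_le_errorProb_add hF B).trans ?_
    rw [add_right_comm]
    gcongr
  refine ⟨?_, ?_, fun Pe hPe0 hPe1 => ⟨fun hC => ?_, ?_⟩⟩
  · refine le_iSup_of_le p (le_iInf fun A => le_trans ?_ (mul_toOuterMeasure_le p A τ))
    -- The bound `56 / N` is useless for small `N`; the constant one covers every positive `N`.
    have h : ENNReal.ofReal (1 - 7 / 8) ≤ p.toOuterMeasure {f | τ ≤ A.solveTime (O f) f ε} := by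
      rw [ENNReal.ofReal_sub _ (by norm_num), ENNReal.ofReal_one, tsub_le_iff_right]
      refine (one_le_toOuterMeasure_add hF A).trans ?_
      gcongr
      exact min_le_left _ _
    refine le_trans ?_ (mul_le_mul_right h _)
    rw [← ENNReal.ofReal_mul (by positivity)]
    exact ENNReal.ofReal_le_ofReal (by linarith)
  · refine le_iSup_of_le p (le_iInf fun A => le_sSup_of_le (b := τ) ?_ hcτ)
    rw [Set.mem_ofPred_eq, ENNReal.ofReal_sub _ hη0, ENNReal.ofReal_one, tsub_le_iff_right]
    refine (one_le_toOuterMeasure_add hF A).trans ?_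
    gcongr
  · refine le_iSup_of_le p (le_iInf fun B => le_iInf fun hBe =>
      le_trans ?_ (mul_probQueriesGE_le p B τ))
    refine le_trans ?_ (mul_le_mul_right (hB Pe hPe0 B hBe) _)
    rw [← ENNReal.ofReal_mul (by positivity)]
    refine ENNReal.ofReal_le_ofReal ?_
    have h1 : N / 64 * (1 - Pe - 56 / N) = ((1 - Pe) * N - 56) / 64 := by
      field_simp
    rw [h1]
    linarith
  · exact le_iSup_of_le p (le_iInf fun B => le_iInf fun hBe =>
      le_sSup_of_le (b := τ) (hB Pe hPe0 B hBe) hcτ)
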